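/- Let $d,k\ge 0$ and $n\ge 1$ be integers and $\sigma>0$. Let $h:\mathbb{R}^d\to\mathbb{R}^k$ be a measurable map (the base embedding) and let $F>0$ satisfy $\|h(y)\|_2\le F$ for all $y\in\mathbb{R}^d$ (for instance $F=\sup_y\|h(y)\|_2$, if $h$ is bounded and not identically zero). Let $g(x)=\mathbb{E}_{z\sim\mathcal{N}(0,\sigma^2 I_d)}[h(x+z)]$ be the smoothed embedding, let $z_1,\dots,z_n$ be independent random vectors with distribution $\mathcal{N}(0,\sigma^2 I_d)$, and let $\hat g(x)=\frac1n\sum_{i=1}^n h(x+z_i)$. Then for every $x\in\mathbb{R}^d$ and every $\epsilon>0$, $$\mathbb{P}\bigl(\|g(x)-\hat g(x)\|_2>\epsilon\bigr)\le (k+1)\exp\left(-\frac{3\epsilon^2 n}{8F^2}\right).$$ -/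

import Mathlib

open MeasureTheory ProbabilityTheory

noncomputable section

namespace RetrievalGuard

/-- The isotropic Gaussian distribution `N(0, σ² I_d)` on `ℝ^d`. -/
def isoGaussian (d : ℕ) (σ : ℝ) : Measure (EuclideanSpace ℝ (Fin d)) :=
  multivariateGaussian 0 (σ ^ 2 • (1 : Matrix (Fin d) (Fin d) ℝ))

/-- The smoothed embedding `g(x) = E_{z ∼ q} [h(x + z)]` of a base embedding `h : ℝ^d → ℝ^k`
with respect to a smoothing distribution `q` on `ℝ^d`. -/
def smoothed {d k : ℕ} (q : Measure (EuclideanSpace ℝ (Fin d)))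
    (h : EuclideanSpace ℝ (Fin d) → EuclideanSpace ℝ (Fin k)) (x : EuclideanSpace ℝ (Fin d)) :
    EuclideanSpace ℝ (Fin k) :=
  ∫ z, h (x + z) ∂q

/-- The Monte-Carlo estimate `ĝ(x) = (1/n) ∑ h(x + z_i)` computed from `n` sample points
`z_1, …, z_n`. -/
def monteCarlo {d k n : ℕ} (h : EuclideanSpace ℝ (Fin d) → EuclideanSpace ℝ (Fin k))
    (z : Fin n → EuclideanSpace ℝ (Fin d)) (x : EuclideanSpace ℝ (Fin d)) :
    EuclideanSpace ℝ (Fin k) :=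
  (1 / (n : ℝ)) • ∑ i, h (x + z i)

end RetrievalGuard

end

/-!
The bound holds with the dimension-free factor `2` in place of `k + 1` as soon as `k ≥ 1`, by
Pinelis' exponential-moment method in a Hilbert space.

Since `u ↦ cosh √u` is convex, `cosh ‖x + v‖ ≤ cosh ‖x‖ * (exp ‖v‖ - ‖v‖) + ⟪c(x), v⟫` for a vector
`c(x)` depending only on `x` (`cosh_norm_add_le`). The linear term vanishes in expectation for a
centred `v` independent of `x`, so `𝔼 cosh (s ‖∑ Xᵢ‖) ≤ Mⁿ`, where `M` bounds
`𝔼 (exp (s ‖Xᵢ‖) - s ‖Xᵢ‖)` (`integral_cosh_norm_sum_le`).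

The constant `3 / 8` comes from the estimate of `M` (`integral_exp_norm_sub_mean_le`). The vector
`X = h(x + z) - g(x)` satisfies both `‖X‖ ≤ F + ‖g(x)‖` and `𝔼 ‖X‖² ≤ F² - ‖g(x)‖²`. A large range
thus forces a small variance, and for `s F ≤ 3 / 2` one gets `M ≤ exp (2 s² F² / 3)` whatever the
value of `‖g(x)‖`. Markov's inequality with `s = 3 ε / (4 F²)` gives `2 exp (-3 ε² n / (8 F²))`; the
condition on `s F` reads `ε ≤ 2 F`, and beyond that the event is empty.
-/

/-! ### Inequalities for `cosh` and `exp` -/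

/-- Convexity of `u ↦ cosh √u` on `[0, ∞)`: its power series has nonnegative coefficients. -/
theorem cosh_le_of_sq_eq {y A B p q : ℝ} (hp : 0 ≤ p) (hq : 0 ≤ q) (hpq : p + q = 1)
    (hy : y ^ 2 = p * A ^ 2 + q * B ^ 2) :
    Real.cosh y ≤ p * Real.cosh A + q * Real.cosh B := by
  refine hasSum_le (fun n => ?_) (Real.hasSum_cosh y)
    (((Real.hasSum_cosh A).mul_left p).add ((Real.hasSum_cosh B).mul_left q))
  have h := (convexOn_pow n).2 (Set.mem_Ici.2 (sq_nonneg A)) (Set.mem_Ici.2 (sq_nonneg B)) hp hq hpq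
  simp only [smul_eq_mul, ← hy, ← pow_mul] at h
  rw [mul_div_assoc', mul_div_assoc', ← add_div]
  gcongr

/-- Up to a term linear in `v`, adding `v` to `x` multiplies `cosh ‖x‖` by at most
`exp ‖v‖ - ‖v‖`. By convexity of `cosh ∘ √` in the cosine of the angle between `x` and `v`, only
parallel vectors matter. At `x = 0` the coefficient `sinh ‖x‖ / ‖x‖` takes its junk value, which is
harmless because it multiplies the zero vector. -/
theorem cosh_norm_add_le {E : Type*} [NormedAddCommGroup E] [InnerProductSpace ℝ E] (x v : E) :
    Real.cosh ‖x + v‖ ≤ Real.cosh ‖x‖ * (Real.exp ‖v‖ - ‖v‖)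
      + inner ℝ ((Real.sinh ‖x‖ / ‖x‖) • x) v := by
  have hsinh : ‖v‖ ≤ Real.sinh ‖v‖ := Real.self_le_sinh_iff.2 (norm_nonneg v)
  have hexp : Real.exp ‖v‖ = Real.cosh ‖v‖ + Real.sinh ‖v‖ := (Real.cosh_add_sinh _).symm
  rcases eq_or_ne x 0 with rfl | hx
  · simp only [zero_add, norm_zero, Real.cosh_zero, smul_zero, inner_zero_left]
    linarith
  rcases eq_or_ne v 0 with rfl | hv
  · simp
  have ha : 0 < ‖x‖ := norm_pos_iff.2 hx
  have hr : 0 < ‖v‖ := norm_pos_iff.2 hv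
  obtain ⟨hc1, hc2⟩ := abs_le.1 (abs_real_inner_div_norm_mul_norm_le_one x v)
  set c : ℝ := inner ℝ x v / (‖x‖ * ‖v‖) with hc
  have hw : inner ℝ x v = c * (‖x‖ * ‖v‖) := by rw [hc]; field_simp
  have hsq : ‖x + v‖ ^ 2
      = (1 + c) / 2 * (‖x‖ + ‖v‖) ^ 2 + (1 - c) / 2 * (‖x‖ - ‖v‖) ^ 2 := by
    rw [norm_add_sq_real, hw]; ring
  have hcosh := cosh_le_of_sq_eq (by linarith) (by linarith) (by ring) hsq
  rw [Real.cosh_add, Real.cosh_sub] at hcosh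
  have hin : inner ℝ ((Real.sinh ‖x‖ / ‖x‖) • x) v = c * Real.sinh ‖x‖ * ‖v‖ := by
    rw [real_inner_smul_left, hw]; field_simp
  rw [hin, hexp]
  have hs0 : 0 ≤ Real.sinh ‖x‖ := Real.sinh_nonneg_iff.2 ha.le
  have h1 : c * Real.sinh ‖x‖ ≤ Real.cosh ‖x‖ :=
    (mul_le_of_le_one_left hs0 hc2).trans (Real.sinh_lt_cosh _).le
  nlinarith [mul_le_mul_of_nonneg_right h1 (sub_nonneg.2 hsinh)]

theorem exp_sub_self_pos (a : ℝ) : 0 < Real.exp a - a := by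
  linarith [Real.add_one_le_exp a]

/-- Taylor bound: beyond order four each ratio of successive terms is at most `1 / 2` on `[0, 3]`,
so the tail is at most twice its first term. -/
theorem exp_le_quintic {a : ℝ} (h0 : 0 ≤ a) (h3 : a ≤ 3) :
    Real.exp a ≤ 1 + a + a ^ 2 / 2 + a ^ 3 / 6 + a ^ 4 / 24 + a ^ 5 / 60 := by
  have hn : ‖(a : ℂ)‖ = a := by simp [abs_of_nonneg h0]
  have h := Complex.exp_bound' (x := (a : ℂ)) (n := 5) (by rw [hn]; push_cast; linarith)
  rw [hn] at h
  have h' := (Complex.re_le_norm _).trans h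
  have e : (Complex.exp (a : ℂ) - ∑ m ∈ Finset.range 5, (a : ℂ) ^ m / m.factorial)
      = ((Real.exp a - ∑ m ∈ Finset.range 5, a ^ m / m.factorial : ℝ) : ℂ) := by push_cast; rfl
  rw [e, Complex.ofReal_re] at h'
  simp only [Finset.sum_range_succ, Finset.range_zero, Finset.sum_empty, Nat.factorial] at h'
  norm_num at h'
  linarith

/-- The numerical inequality behind the constant `3 / 8`. Here `b = 1 + ‖g‖ / F`, so that a centred
observation has norm at most `b F` and variance at most `b (2 - b) F ^ 2`: the variance drops as the
range grows. -/
theorem quintic_le_exp_sub_one {b s : ℝ} (hb1 : 1 ≤ b) (hb2 : b ≤ 2) (hs : 0 ≤ s) :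
    b * (2 - b) * (s ^ 2 / 2 + s ^ 3 * b / 6 + s ^ 4 * b ^ 2 / 24 + s ^ 5 * b ^ 3 / 60)
      ≤ Real.exp (2 * s ^ 2 / 3) - 1 := by
  have hE : 1 + 2 * s ^ 2 / 3 + 2 * s ^ 4 / 9 + 4 * s ^ 6 / 81 ≤ Real.exp (2 * s ^ 2 / 3) := by
    have := Real.sum_le_exp_of_nonneg (x := 2 * s ^ 2 / 3) (by positivity) 4
    simp only [Finset.sum_range_succ, Finset.range_zero, Finset.sum_empty, Nat.factorial] at this
    norm_num at this
    nlinarith [this]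
  -- `b ^ m * (2 - b)` is maximal at `b = 2 * m / (m + 1)`, which gives the squares for `m = 1, 2, 3`;
  -- a cruder bound is enough for `m = 4`.
  have c0 : b * (2 - b) ≤ 1 := by nlinarith [sq_nonneg (b - 1)]
  have c1 : b ^ 2 * (2 - b) ≤ 6 / 5 := by
    nlinarith [mul_nonneg (by linarith : 0 ≤ b + 2 / 3) (sq_nonneg (b - 4 / 3))]
  have c2 : b ^ 3 * (2 - b) ≤ 27 / 16 := by
    nlinarith [mul_nonneg (by nlinarith : 0 ≤ b ^ 2 + b + 3 / 4) (sq_nonneg (b - 3 / 2))]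
  have c3 : b ^ 4 * (2 - b) ≤ 27 / 8 := by
    nlinarith [mul_nonneg (by positivity : 0 ≤ b ^ 3) (sub_nonneg.2 hb2)]
  have hq : 1 / 2 + s / 5 + 9 / 128 * s ^ 2 + 9 / 160 * s ^ 3
      ≤ 2 / 3 + 2 * s ^ 2 / 9 + 4 * s ^ 4 / 81 := by
    nlinarith [sq_nonneg (s - 0.6), sq_nonneg (s ^ 2 - s), sq_nonneg (s ^ 2 - 0.6 * s), sq_nonneg s]
  have h2 : 0 ≤ s ^ 2 := by positivity
  calc b * (2 - b) * (s ^ 2 / 2 + s ^ 3 * b / 6 + s ^ 4 * b ^ 2 / 24 + s ^ 5 * b ^ 3 / 60)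
      = s ^ 2 * (b * (2 - b) * (1 / 2) + b ^ 2 * (2 - b) * (s / 6) + b ^ 3 * (2 - b) * (s ^ 2 / 24)
          + b ^ 4 * (2 - b) * (s ^ 3 / 60)) := by ring
    _ ≤ s ^ 2 * (1 * (1 / 2) + 6 / 5 * (s / 6) + 27 / 16 * (s ^ 2 / 24)
          + 27 / 8 * (s ^ 3 / 60)) := by gcongr
    _ ≤ s ^ 2 * (2 / 3 + 2 * s ^ 2 / 9 + 4 * s ^ 4 / 81) := by
        exact mul_le_mul_of_nonneg_left (by linarith) h2
    _ ≤ _ := by linarith [hE]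

/-! ### Concentration in a Hilbert space -/

section Hilbert

variable {Ω E : Type*} [MeasurableSpace Ω] {P : Measure Ω} [IsProbabilityMeasure P]
  [NormedAddCommGroup E] [InnerProductSpace ℝ E] [CompleteSpace E] [SecondCountableTopology E]
  [MeasurableSpace E] [BorelSpace E]

/-- One step of Pinelis' argument: the linear term of `cosh_norm_add_le` integrates to zero, as `X`
is centred and independent of `S`. -/
theorem integral_cosh_norm_add_le {S X : Ω → E} {B C : ℝ} (hS : AEMeasurable S P)
    (hX : AEMeasurable X P) (hSX : IndepFun S X P) (hSB : ∀ ω, ‖S ω‖ ≤ B)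
    (hXC : ∀ ω, ‖X ω‖ ≤ C) (hX0 : ∫ ω, X ω ∂P = 0) :
    ∫ ω, Real.cosh ‖S ω + X ω‖ ∂P
      ≤ (∫ ω, Real.cosh ‖S ω‖ ∂P) * ∫ ω, (Real.exp ‖X ω‖ - ‖X ω‖) ∂P := by
  have hcosh {Y : Ω → E} {D : ℝ} (hY : AEMeasurable Y P) (hD : ∀ ω, ‖Y ω‖ ≤ D) :
      Integrable (fun ω => Real.cosh ‖Y ω‖) P := by
    refine .of_bound (by fun_prop) (Real.cosh D) (.of_forall fun ω => ?_)
    rw [Real.norm_of_nonneg (Real.cosh_pos _).le, Real.cosh_le_cosh, abs_norm]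
    exact (hD ω).trans (le_abs_self D)
  have hXi : Integrable X P := .of_bound hX.aestronglyMeasurable C (.of_forall hXC)
  have hψ : Integrable (fun ω => Real.exp ‖X ω‖ - ‖X ω‖) P := by
    refine .sub (.of_bound (by fun_prop) (Real.exp C) (.of_forall fun ω => ?_)) hXi.norm
    rw [Real.norm_of_nonneg (Real.exp_pos _).le]
    exact Real.exp_le_exp.2 (hXC ω)
  let V : E → E := fun y => (Real.sinh ‖y‖ / ‖y‖) • y
  have hV : Measurable V := by
    have : Measurable Real.sinh := Real.continuous_sinh.measurable
    fun_prop
  have hVS : Integrable (fun ω => V (S ω)) P := by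
    refine .of_bound (hV.comp_aemeasurable hS).aestronglyMeasurable (Real.cosh B)
      (.of_forall fun ω => ?_)
    have h0 : 0 ≤ Real.sinh ‖S ω‖ := Real.sinh_nonneg_iff.2 (norm_nonneg _)
    rw [norm_smul, Real.norm_of_nonneg (by positivity)]
    have hdiv : Real.sinh ‖S ω‖ / ‖S ω‖ * ‖S ω‖ ≤ Real.sinh ‖S ω‖ := by
      rw [div_mul_eq_mul_div]
      exact div_le_of_le_mul₀ (norm_nonneg _) h0 le_rfl
    refine hdiv.trans ?_
    refine (Real.sinh_lt_cosh _).le.trans ?_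
    rw [Real.cosh_le_cosh, abs_norm]
    exact (hSB ω).trans (le_abs_self B)
  have hind1 : IndepFun (fun ω => Real.cosh ‖S ω‖) (fun ω => Real.exp ‖X ω‖ - ‖X ω‖) P :=
    hSX.comp (φ := fun y : E => Real.cosh ‖y‖) (ψ := fun y : E => Real.exp ‖y‖ - ‖y‖)
      (by fun_prop) (by fun_prop)
  have hind2 : IndepFun (fun ω => V (S ω)) X P := hSX.comp (ψ := id) hV measurable_id
  have hint1 : Integrable (fun ω => Real.cosh ‖S ω‖ * (Real.exp ‖X ω‖ - ‖X ω‖)) P :=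
    hind1.integrable_mul (hcosh hS hSB) hψ
  have hint2 : Integrable (fun ω => inner ℝ (V (S ω)) (X ω)) P :=
    hind2.integrable_bilin hVS hXi (innerSL ℝ)
  have hzero : ∫ ω, inner ℝ (V (S ω)) (X ω) ∂P = 0 := by
    have := hind2.integral_bilin hVS hXi (innerSL ℝ)
    rw [hX0, map_zero] at this
    exact this
  calc ∫ ω, Real.cosh ‖S ω + X ω‖ ∂P
      ≤ ∫ ω, (Real.cosh ‖S ω‖ * (Real.exp ‖X ω‖ - ‖X ω‖) + inner ℝ (V (S ω)) (X ω)) ∂P :=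
        integral_mono (hcosh (hS.add hX) (D := B + C) fun ω =>
          (norm_add_le _ _).trans (add_le_add (hSB ω) (hXC ω)))
          (hint1.add hint2) fun ω => cosh_norm_add_le _ _
    _ = ∫ ω, Real.cosh ‖S ω‖ * (Real.exp ‖X ω‖ - ‖X ω‖) ∂P := by
        rw [integral_add hint1 hint2, hzero, add_zero]
    _ = _ := hind1.integral_fun_mul_eq_mul_integral (hcosh hS hSB).1 hψ.1

theorem integral_cosh_norm_sum_le {ι : Type*} {X : ι → Ω → E} {C M : ℝ}
    (hX : ∀ i, AEMeasurable (X i) P) (hind : iIndepFun X P) (hC : ∀ i ω, ‖X i ω‖ ≤ C)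
    (h0 : ∀ i, ∫ ω, X i ω ∂P = 0) (hM : ∀ i, ∫ ω, (Real.exp ‖X i ω‖ - ‖X i ω‖) ∂P ≤ M)
    (s : Finset ι) :
    ∫ ω, Real.cosh ‖∑ i ∈ s, X i ω‖ ∂P ≤ M ^ s.card := by
  classical
  induction s using Finset.induction_on with
  | empty => simp
  | insert i s hi ih =>
    have hsum : (fun ω => ∑ j ∈ s, X j ω) = ∑ j ∈ s, X j := by ext; simp
    have hstep := integral_cosh_norm_add_le (S := fun ω => ∑ j ∈ s, X j ω) (X := X i)
      (B := s.card * C) (Finset.aemeasurable_fun_sum s fun j _ => hX j) (hX i)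
      (hsum ▸ hind.indepFun_finsetSum_of_notMem₀ hX hi)
      (fun ω => (norm_sum_le _ _).trans <| by
        simpa using Finset.sum_le_card_nsmul s (fun j => ‖X j ω‖) C fun j _ => hC j ω)
      (hC i) (h0 i)
    have hM0 : 0 ≤ M := (integral_nonneg fun ω => (exp_sub_self_pos _).le).trans (hM i)
    rw [Finset.card_insert_of_notMem hi, pow_succ]
    simp only [Finset.sum_insert hi, add_comm (X i _)]
    exact hstep.trans (mul_le_mul ih (hM i) (integral_nonneg fun ω => (exp_sub_self_pos _).le)
      (by positivity))

/-- Moment bound for the centring of a vector bounded by `F`. With `g` the mean, the centred vector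
has norm at most `F + ‖g‖` and second moment at most `F ^ 2 - ‖g‖ ^ 2`. -/
theorem integral_exp_norm_sub_mean_le {H : Ω → E} {F s : ℝ} (hH : AEMeasurable H P) (hF : 0 < F)
    (hHF : ∀ ω, ‖H ω‖ ≤ F) (hs : 0 ≤ s) (hsF : s * F ≤ 3 / 2) :
    ∫ ω, (Real.exp ‖s • (H ω - ∫ ω', H ω' ∂P)‖ - ‖s • (H ω - ∫ ω', H ω' ∂P)‖) ∂P
      ≤ Real.exp (2 * (s * F) ^ 2 / 3) := by
  set g : E := ∫ ω', H ω' ∂P with hg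
  have hgF : ‖g‖ ≤ F := by
    simpa using norm_integral_le_of_norm_le_const (μ := P) (.of_forall hHF)
  have hHi : Integrable H P := .of_bound hH.aestronglyMeasurable F (.of_forall hHF)
  have hb (ω : Ω) : ‖H ω - g‖ ≤ F + ‖g‖ :=
    (norm_sub_le _ _).trans (add_le_add_left (hHF ω) _)
  have hsq : Integrable (fun ω => ‖H ω - g‖ ^ 2) P := by
    refine .of_bound (by fun_prop) ((F + ‖g‖) ^ 2) (.of_forall fun ω => ?_)
    rw [Real.norm_of_nonneg (by positivity)]
    exact pow_le_pow_left₀ (norm_nonneg _) (hb ω) 2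
  have hvar : ∫ ω, ‖H ω - g‖ ^ 2 ∂P ≤ F ^ 2 - ‖g‖ ^ 2 := by
    have hin : Integrable (fun ω => inner ℝ g (H ω)) P := hHi.const_inner g
    have hinE : ∫ ω, inner ℝ g (H ω) ∂P = ‖g‖ ^ 2 := by
      rw [integral_inner hHi, ← hg, real_inner_self_eq_norm_sq]
    calc ∫ ω, ‖H ω - g‖ ^ 2 ∂P ≤ ∫ ω, (F ^ 2 + ‖g‖ ^ 2 - 2 * inner ℝ g (H ω)) ∂P := by
          refine integral_mono hsq ((integrable_const _).sub (hin.const_mul 2)) fun ω => ?_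
          have := pow_le_pow_left₀ (norm_nonneg _) (hHF ω) 2
          show ‖H ω - g‖ ^ 2 ≤ _
          rw [norm_sub_sq_real, real_inner_comm]
          linarith
      _ = F ^ 2 - ‖g‖ ^ 2 := by
          rw [integral_sub (integrable_const _) (hin.const_mul 2), integral_const_mul, hinE]
          simp; ring
  set K : ℝ := s ^ 2 / 2 + s ^ 3 * (F + ‖g‖) / 6 + s ^ 4 * (F + ‖g‖) ^ 2 / 24
    + s ^ 5 * (F + ‖g‖) ^ 3 / 60 with hK
  have hK0 : 0 ≤ K := by positivity
  have hpt (ω : Ω) : Real.exp ‖s • (H ω - g)‖ - ‖s • (H ω - g)‖ ≤ 1 + ‖H ω - g‖ ^ 2 * K := by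
    rw [norm_smul, Real.norm_of_nonneg hs]
    set r := ‖H ω - g‖
    have hr0 : 0 ≤ r := norm_nonneg _
    have hrb : r ≤ F + ‖g‖ := hb ω
    have h3 : s * r ≤ 3 := by
      nlinarith [mul_le_mul_of_nonneg_left (hrb.trans (add_le_add_right hgF F)) hs]
    have h1 := exp_le_quintic (mul_nonneg hs hr0) h3
    have h2 : r ^ 2 * (s ^ 2 / 2 + s ^ 3 * r / 6 + s ^ 4 * r ^ 2 / 24 + s ^ 5 * r ^ 3 / 60)
        ≤ r ^ 2 * K := by rw [hK]; gcongr
    nlinarith [h1, h2]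
  have hpoly := quintic_le_exp_sub_one (b := 1 + ‖g‖ / F) (s := s * F)
    (le_add_of_nonneg_right (by positivity))
    (by linarith [(div_le_one hF).2 hgF]) (by positivity)
  have hscale : (F ^ 2 - ‖g‖ ^ 2) * K = (1 + ‖g‖ / F) * (2 - (1 + ‖g‖ / F)) * ((s * F) ^ 2 / 2
      + (s * F) ^ 3 * (1 + ‖g‖ / F) / 6 + (s * F) ^ 4 * (1 + ‖g‖ / F) ^ 2 / 24
      + (s * F) ^ 5 * (1 + ‖g‖ / F) ^ 3 / 60) := by
    rw [hK]; field_simp; ring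
  calc _ ≤ ∫ ω, (1 + ‖H ω - g‖ ^ 2 * K) ∂P := by
        exact integral_mono_of_nonneg (.of_forall fun ω => (exp_sub_self_pos _).le)
          ((integrable_const _).add (hsq.mul_const K)) (.of_forall hpt)
    _ = 1 + (∫ ω, ‖H ω - g‖ ^ 2 ∂P) * K := by
        rw [integral_add (integrable_const _) (hsq.mul_const K), integral_mul_const]
        simp
    _ ≤ 1 + (F ^ 2 - ‖g‖ ^ 2) * K := by gcongr
    _ ≤ _ := by rw [hscale]; linarith

/-- Dimension-free concentration of the empirical mean of bounded vectors in a Hilbert space. -/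
theorem measureReal_lt_norm_average_sub_mean_le {n : ℕ} (hn : 0 < n) {H : Fin n → Ω → E} {g : E}
    {F ε : ℝ} (hH : ∀ i, AEMeasurable (H i) P) (hind : iIndepFun H P) (hF : 0 < F)
    (hHF : ∀ i ω, ‖H i ω‖ ≤ F) (hg : ∀ i, ∫ ω, H i ω ∂P = g) (hε : 0 < ε) :
    P.real {ω | ε < ‖(1 / (n : ℝ)) • ∑ i, H i ω - g‖}
      ≤ 2 * Real.exp (-(3 * ε ^ 2 * n / (8 * F ^ 2))) := by
  have hn' : (0 : ℝ) < n := by exact_mod_cast hn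
  have hgF : ‖g‖ ≤ F := by
    rw [← hg ⟨0, hn⟩]
    simpa using norm_integral_le_of_norm_le_const (μ := P) (.of_forall (hHF ⟨0, hn⟩))
  have hmean (ω : Ω) : (1 / (n : ℝ)) • ∑ i, H i ω - g = (1 / (n : ℝ)) • ∑ i, (H i ω - g) := by
    rw [Finset.sum_sub_distrib, smul_sub, Finset.sum_const, Finset.card_univ, Fintype.card_fin,
      ← Nat.cast_smul_eq_nsmul ℝ, smul_smul, one_div_mul_cancel hn'.ne', one_smul]
  simp_rw [hmean]
  have hXb (i : Fin n) (ω : Ω) : ‖H i ω - g‖ ≤ 2 * F :=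
    (norm_sub_le _ _).trans (by linarith [hHF i ω])
  -- The event is empty for `ε ≥ 2 * F`; below that, `s * F ≤ 3 / 2` for the `s` chosen next.
  rcases le_or_gt (2 * F) ε with hbig | hsmall
  · have hempty : {ω | ε < ‖(1 / (n : ℝ)) • ∑ i, (H i ω - g)‖} = ∅ := by
      refine Set.eq_empty_of_forall_notMem fun ω hω => ?_
      have h1 : ‖∑ i, (H i ω - g)‖ ≤ n * (2 * F) := (norm_sum_le _ _).trans <| by
        simpa using Finset.sum_le_card_nsmul Finset.univ (fun i => ‖H i ω - g‖) (2 * F)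
          fun i _ => hXb i ω
      have h2 : ‖(1 / (n : ℝ)) • ∑ i, (H i ω - g)‖ ≤ 2 * F := by
        rw [norm_smul, Real.norm_of_nonneg (by positivity), one_div, inv_mul_le_iff₀ hn']
        exact h1
      exact absurd (h2.trans hbig) (not_le.2 hω)
    rw [hempty, measureReal_empty]
    positivity
  -- This `s` minimises the Chernoff exponent `2 * (s * F) ^ 2 / 3 - s * ε`.
  set s : ℝ := 3 * ε / (4 * F ^ 2) with hs
  have hs0 : 0 < s := by positivity
  have hsF : s * F ≤ 3 / 2 := by
    have : s * F = 3 * ε / (4 * F) := by rw [hs]; field_simp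
    rw [this, div_le_iff₀ (by positivity)]
    linarith
  let X : Fin n → Ω → E := fun i ω => s • (H i ω - g)
  have hX (i : Fin n) : AEMeasurable (X i) P := ((hH i).sub_const g).const_smul s
  have hmom : ∫ ω, Real.cosh ‖∑ i, X i ω‖ ∂P ≤ Real.exp (2 * (s * F) ^ 2 / 3) ^ n := by
    have := integral_cosh_norm_sum_le (X := X) (C := s * (2 * F)) hX
      (hind.comp (fun _ y => s • (y - g)) fun _ => by fun_prop)
      (fun i ω => by
        rw [norm_smul, Real.norm_of_nonneg hs0.le]
        exact mul_le_mul_of_nonneg_left (hXb i ω) hs0.le)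
      (fun i => by
        have hi : Integrable (H i) P := .of_bound (hH i).aestronglyMeasurable F
          (.of_forall (hHF i))
        rw [integral_smul, integral_sub hi (integrable_const g), hg i]
        simp)
      (fun i => by
        simpa only [hg i] using integral_exp_norm_sub_mean_le (hH i) hF (hHF i) hs0.le hsF)
      Finset.univ
    simpa using this
  have hsub : {ω | ε < ‖(1 / (n : ℝ)) • ∑ i, (H i ω - g)‖}
      ⊆ {ω | Real.exp (s * (n * ε)) / 2 ≤ Real.cosh ‖∑ i, X i ω‖} := by
    intro ω hω
    rw [Set.mem_ofPred_eq, norm_smul, Real.norm_of_nonneg (by positivity), one_div,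
      lt_inv_mul_iff₀ hn'] at hω
    have hnorm : ‖∑ i, X i ω‖ = s * ‖∑ i, (H i ω - g)‖ := by
      rw [← Finset.smul_sum, norm_smul, Real.norm_of_nonneg hs0.le]
    rw [Set.mem_ofPred_eq, hnorm, Real.cosh_eq]
    have h1 : Real.exp (s * (n * ε)) ≤ Real.exp (s * ‖∑ i, (H i ω - g)‖) :=
      Real.exp_le_exp.2 (mul_le_mul_of_nonneg_left hω.le hs0.le)
    have h2 := Real.exp_pos (-(s * ‖∑ i, (H i ω - g)‖))
    linarith
  have hint : Integrable (fun ω => Real.cosh ‖∑ i, X i ω‖) P := by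
    refine .of_bound ?_ (Real.cosh (n * (s * (2 * F)))) (.of_forall fun ω => ?_)
    · have := Finset.aemeasurable_fun_sum Finset.univ fun i _ => hX i
      fun_prop
    · rw [Real.norm_of_nonneg (Real.cosh_pos _).le, Real.cosh_le_cosh, abs_norm]
      refine ((norm_sum_le _ _).trans ?_).trans (le_abs_self _)
      simpa using Finset.sum_le_card_nsmul Finset.univ (fun i => ‖X i ω‖) (s * (2 * F))
        fun i _ => by
          rw [norm_smul, Real.norm_of_nonneg hs0.le]
          exact mul_le_mul_of_nonneg_left (hXb i ω) hs0.le
  have hmarkov := mul_meas_ge_le_integral_of_nonneg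
    (.of_forall fun ω => (Real.cosh_pos ‖∑ i, X i ω‖).le) hint (Real.exp (s * (n * ε)) / 2)
  have hexp : Real.exp (2 * (s * F) ^ 2 / 3) ^ n
      = Real.exp (s * (n * ε)) * Real.exp (-(3 * ε ^ 2 * n / (8 * F ^ 2))) := by
    rw [← Real.exp_nat_mul, ← Real.exp_add, hs]
    congr 1
    field_simp
    ring
  have hE := Real.exp_pos (s * (n * ε))
  have hfin := (mul_le_mul_of_nonneg_left (measureReal_mono (μ := P) hsub) (half_pos hE).le).trans
    (hmarkov.trans hmom)
  rw [hexp] at hfin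
  refine le_of_mul_le_mul_left ?_ (half_pos hE)
  linarith

end Hilbert

/-! ### The smoothed embedding -/

theorem lemma3 {Ω : Type*} [MeasurableSpace Ω] (P : Measure Ω) [IsProbabilityMeasure P]
    (d k n : ℕ) (hn : 0 < n) (σ : ℝ) (hσ : 0 < σ)
    (h : EuclideanSpace ℝ (Fin d) → EuclideanSpace ℝ (Fin k)) (hmeas : Measurable h)
    (F : ℝ) (hF : 0 < F) (hbound : ∀ y, ‖h y‖ ≤ F)
    (z : Fin n → Ω → EuclideanSpace ℝ (Fin d))
    (hindep : iIndepFun z P)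
    (hlaw : ∀ i, HasLaw (z i) (RetrievalGuard.isoGaussian d σ) P)
    (x : EuclideanSpace ℝ (Fin d)) (ε : ℝ) (hε : 0 < ε) :
    P.real {ω | ‖RetrievalGuard.smoothed (RetrievalGuard.isoGaussian d σ) h x
        - RetrievalGuard.monteCarlo h (fun i => z i ω) x‖ > ε}
      ≤ ((k : ℝ) + 1) * Real.exp (-(3 * ε ^ 2 * (n : ℝ) / (8 * F ^ 2))) := by
  have hm : Measurable fun y => h (x + y) := by fun_prop
  rcases Nat.eq_zero_or_pos k with rfl | hk
  · -- The event is empty in `ℝ⁰`; the factor `2` of the general bound exceeds `k + 1 = 1`.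
    have hempty : {ω | ‖RetrievalGuard.smoothed (RetrievalGuard.isoGaussian d σ) h x
        - RetrievalGuard.monteCarlo h (fun i => z i ω) x‖ > ε} = ∅ :=
      Set.eq_empty_of_forall_notMem fun ω hω => by
        rw [Set.mem_ofPred_eq, Subsingleton.elim (_ - _) (0 : EuclideanSpace ℝ (Fin 0)),
          norm_zero] at hω
        exact hω.not_gt hε
    rw [hempty, measureReal_empty]
    positivity
  have hmain := measureReal_lt_norm_average_sub_mean_le (P := P) hn
    (H := fun i ω => h (x + z i ω))
    (g := RetrievalGuard.smoothed (RetrievalGuard.isoGaussian d σ) h x)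
    (fun i => hm.comp_aemeasurable (hlaw i).aemeasurable)
    (hindep.comp (fun _ y => h (x + y)) fun _ => hm) hF (fun i ω => hbound _)
    (fun i => (hlaw i).integral_comp hm.aestronglyMeasurable) hε
  have hk' : (1 : ℝ) ≤ k := by exact_mod_cast hk
  simp only [norm_sub_rev (RetrievalGuard.smoothed _ _ _)]
  refine hmain.trans ?_
  gcongr
  linarith
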